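/- Let $T$ be a complete first-order theory in a language $L$, with cardinality $|T|=|L|+\aleph_0$, and let $\mathfrak C$ be a monster model of $T$: for some cardinal $\mu$ it is $\mu$-saturated and strongly $\mu$-homogeneous (every partial elementary map whose domain has cardinality $<\mu$ extends to an automorphism). Small means of cardinality $<\mu$. Let $\perp$, written $A\perp_B D$, be a symmetric independence relation on $\mathfrak C$: a ternary relation on small subsets of $\mathfrak C$ such that, for all small sets, * (Invariance) $A\perp_B D$ implies $\sigma(A)\perp_{\sigma(B)}\sigma(D)$ for every $\sigma\in\mathrm{Aut}(\mathfrak C)$; * (Normality) $A\perp_B D$ implies $A\cup B\perp_B D$; * (Symmetry) $A\perp_B D$ implies $D\perp_B A$; * (Transitivity) if $B\subseteq D\subseteq E$, then $A\perp_B E$ if and only if $A\perp_B D$ and $A\perp_D E$; * (Finite character) $A\perp_B D$ if and only if $A_0\perp_B D$ for all finite $A_0\subseteq A$; * (Extension) there is $A'\equiv_B A$ with $A'\perp_B D$; * (Local character) there is a small cardinal $\lambda_0$, depending only on $\perp$, such that for all small $A,D$ there is $D_0\subseteq D$ with $|D_0|<\lambda_0+|A|^+$ and $A\perp_{D_0}D$.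 Let $\kappa_0$ be the least regular cardinal such that for every finite $A$ and every small $B$ there is $B_0\subseteq B$ with $|B_0|<\kappa_0$ and $A\perp_{B_0}B$. Fix a small cardinal $\kappa>\max(\kappa_0,|T|)$; very small means of cardinality $<\kappa$. Let $P$ be a new unary predicate and $L^2=L\cup\{P\}$. Models of $T$ are taken to be elementary substructures of $\mathfrak C$. For an expansion $M_P=\langle M,P(M)\rangle$ of such a model $M$ by an arbitrary subset $P(M)\subseteq M$, put $P(A)=P(M)\cap A$ for $A\subseteq M$. For a complete $L$-type $q$ over $A$ and $B,D\subseteq A$, write $q\perp_B D$ if a realization $c$ of $q$ in $\mathfrak C$ satisfies $c\perp_B D$. The pair $M_P$ is a $\perp$-lovely pair if 1. $M$ is small; 2. (Density) for every very small $A\subseteq M$, every complete $L$-$1$-type $q$ over $A$ with $q\perp_{P(A)}A$ is realized in $P(M)$; 3. (Extension) for every very small $A\subseteq M$, every complete $L$-$1$-type $q$ over $A$ is realized by some $b\in M$ with $b\perp_A P(M)$. A tuple $\bar a$ from $M$ is $P$-independent if $\bar a\perp_{P(\bar a)}P(M)$, and its $P$-type is the set of indices of its members that lie in $P(M)$. **Proposition.**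 Let $M_P$ and $M'_P$ be two $\perp$-lovely pairs for $T$ (with respect to the same $\kappa$). Let $\bar a$ be a $P$-independent very small tuple from $M$ (possibly infinite), and let $\bar a'$ be a $P$-independent tuple of the same length from $M'$. If $\bar a$ and $\bar a'$ have the same $L$-type and the same $P$-type, then they have the same $L^2$-type: for every $L^2$-formula $\varphi$, $M_P\models\varphi(\bar a)$ if and only if $M'_P\models\varphi(\bar a')$. -/

import Mathlib

open FirstOrder Cardinal

universe u v w x

namespace LovelyPairs

/-- Two tuples indexed by `ι`, from possibly different `L`-structures, have the same `L`-type. -/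
def SameType (L : FirstOrder.Language.{u, v}) {M N : Type*} [L.Structure M] [L.Structure N] {ι : Type*}
    (a : ι → M) (b : ι → N) : Prop :=
  ∀ φ : L.Formula ι, φ.Realize a ↔ φ.Realize b

/-- The complete `L`-`1`-types over the set `A` of parameters from `C`. -/
abbrev OneType (L : FirstOrder.Language.{u, v}) {C : Type w} [L.Structure C] (A : Set C) :=
  (L[[A]].completeTheory C).CompleteType (Fin 1)

/-- The element `c` realizes the complete `1`-type `q` over `A`. -/
def Realizes {L : FirstOrder.Language.{u, v}} {C : Type w} [L.Structure C] [Nonempty C] {A : Set C}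
    (c : C) (q : OneType L A) : Prop :=
  (L[[A]].completeTheory C).typeOf (fun _ : Fin 1 => c) = q

/-- The cardinality `|T|` of a complete theory in the language `L`. -/
noncomputable def theoryCard (L : FirstOrder.Language.{u, v}) : Cardinal.{max u v} := max ℵ₀ L.card

/-- `C` is a monster model, of monstrosity `μ`, of the complete theory `T`: it is a `μ`-saturated
and strongly `μ`-homogeneous model of `T`. A set is small if its cardinality is `< μ`. -/
structure IsMonsterModel {L : FirstOrder.Language.{u, v}} (T : L.Theory) (C : Type w) [L.Structure C]
    [Nonempty C] (μ : Cardinal.{w}) : Prop where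
  complete : T.IsComplete
  model : C ⊨ T
  saturated : ∀ A : Set C, #A < μ → ∀ q : OneType L A, ∃ c : C, Realizes c q
  homogeneous : ∀ (A : Set C) (f : A → C), #A < μ → SameType L (fun a : A => (a : C)) f →
    ∃ σ : C ≃[L] C, ∀ a : A, σ a = f a

/-- `Ind A B D`, read `A ⫝_B D` (the base is the middle argument), is a symmetric independence
relation on the small subsets of `C`. Its values on sets that are not small are irrelevant. -/
structure IsIndependenceRelation (L : FirstOrder.Language.{u, v}) {C : Type w} [L.Structure C]
    (μ : Cardinal.{w}) (Ind : Set C → Set C → Set C → Prop) : Prop where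
  invariance : ∀ A B D : Set C, #A < μ → #B < μ → #D < μ → ∀ σ : C ≃[L] C,
    Ind A B D → Ind (σ '' A) (σ '' B) (σ '' D)
  normality : ∀ A B D : Set C, #A < μ → #B < μ → #D < μ → Ind A B D → Ind (A ∪ B) B D
  symmetry : ∀ A B D : Set C, #A < μ → #B < μ → #D < μ → Ind A B D → Ind D B A
  transitivity : ∀ A B D E : Set C, #A < μ → #B < μ → #D < μ → #E < μ → B ⊆ D → D ⊆ E →
    (Ind A B E ↔ Ind A B D ∧ Ind A D E)
  finite_character : ∀ A B D : Set C, #A < μ → #B < μ → #D < μ →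
    (Ind A B D ↔ ∀ A₀ ⊆ A, A₀.Finite → Ind A₀ B D)
  extension : ∀ A B D : Set C, #A < μ → #B < μ → #D < μ →
    ∃ f : A → C, SameType (L[[B]]) (fun a : A => (a : C)) f ∧ Ind (Set.range f) B D
  local_character : ∃ κ₀ < μ, ∀ A D : Set C, #A < μ → #D < μ →
    ∃ D₀ ⊆ D, #D₀ < κ₀ + Order.succ #A ∧ Ind A D₀ D

/-- The cardinal `κ₀` of an independence relation: the least regular cardinal `κ` such that every
finite `A` and small `B` admit `B₀ ⊆ B` with `|B₀| < κ` and `A ⫝_{B₀} B`. -/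
noncomputable def kappaZero {C : Type w} (μ : Cardinal.{w})
    (Ind : Set C → Set C → Set C → Prop) : Cardinal.{w} :=
  sInf {κ | κ.IsRegular ∧ ∀ A B : Set C, A.Finite → #B < μ →
    ∃ B₀ ⊆ B, #B₀ < κ ∧ Ind A B₀ B}

/-- `q ⫝_B D` for a complete `1`-type `q` over `A` (used with `A` small and `B, D ⊆ A`). -/
def TypeInd {L : FirstOrder.Language.{u, v}} {C : Type w} [L.Structure C] [Nonempty C]
    (Ind : Set C → Set C → Set C → Prop) {A : Set C} (q : OneType L A) (B D : Set C) : Prop :=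
  ∃ c : C, Realizes c q ∧ Ind {c} B D

/-- The relation symbols of the language with a single unary predicate symbol `P`. -/
inductive predRel : ℕ → Type
  | P : predRel 1

/-- The language whose only symbol is the unary predicate symbol `P`. -/
def predLang : FirstOrder.Language.{0, 0} := ⟨fun _ => Empty, predRel⟩

/-- The language `L² = L ∪ {P}`. -/
abbrev pairLang (L : FirstOrder.Language.{u, v}) : FirstOrder.Language.{u, v} := L.sum predLang

/-- A pair `M_P = ⟨M, P(M)⟩`, with `M` an elementary substructure of `C` and `P(M) ⊆ M`. -/
structure Pair (L : FirstOrder.Language.{u, v}) (C : Type w) [L.Structure C] where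
  M : L.ElementarySubstructure C
  P : Set C
  P_subset : P ⊆ (M : Set C)

/-- The interpretation of the predicate symbol `P` in the pair. Together with the `L`-structure
of `M` it makes `M` an `L²`-structure. -/
instance Pair.predStructure {L : FirstOrder.Language.{u, v}} {C : Type w} [L.Structure C] (X : Pair L C) :
    predLang.Structure X.M where
  funMap := fun f _ => f.elim
  RelMap := fun r xs => match r, xs with
    | predRel.P, xs => (xs 0 : C) ∈ X.P

/-- `M_P` is a `⫝`-lovely pair (a `κ`-lovely pair), where very small means of cardinality
`< κ`. -/
structure IsLovely {L : FirstOrder.Language.{u, v}} {C : Type w} [L.Structure C] [Nonempty C]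
    (μ κ : Cardinal.{w}) (Ind : Set C → Set C → Set C → Prop) (X : Pair L C) : Prop where
  small : #X.M < μ
  density : ∀ A ⊆ (X.M : Set C), #A < κ → ∀ q : OneType L A, TypeInd Ind q (X.P ∩ A) A →
    ∃ b ∈ X.P, Realizes b q
  extension : ∀ A ⊆ (X.M : Set C), #A < κ → ∀ q : OneType L A,
    ∃ b ∈ X.M, Realizes b q ∧ Ind {b} A X.P

/-- A set `A ⊆ M` is `P`-independent if `A ⫝_{P(A)} P(M)`, where `P(A) = P(M) ∩ A`. -/
def PIndependent {L : FirstOrder.Language.{u, v}} {C : Type w} [L.Structure C]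
    (Ind : Set C → Set C → Set C → Prop) (X : Pair L C) (A : Set C) : Prop :=
  Ind A (X.P ∩ A) X.P

/-- The `P`-type of a tuple: the set of indices of its members that lie in `P(M)`. -/
def PType {L : FirstOrder.Language.{u, v}} {C : Type w} [L.Structure C] {ι : Type x} (X : Pair L C)
    (a : ι → X.M) : Set ι :=
  {i | (a i : C) ∈ X.P}

end LovelyPairs

/-!
The proof is a back-and-forth argument. The positions of the game are the very small partial
elementary maps from `M` to `M'` that respect `P` and whose domain and image are `P`-independent
(`LovelyPairs.IsPartialIso`); they are encoded by their graphs, so that the inverse of a position is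
obtained by swapping coordinates and one direction of the game suffices. The map `a i ↦ a' i` is a
position, and positions preserve the formulas of `L²` as soon as they can be extended to any further
element of `M` (`LovelyPairs.IsPartialIso.forth`).

Let a position have domain `A` and let `b ∈ M`. By homogeneity of the monster model the position
extends to an automorphism, which carries types over `A` to types over the image.

* If `b ∈ P(M)`, then `b ⫝_{P(A)} A`, as `A` is `P`-independent. Density of the other pair realizes
  the transported type in `P(M')`. Adding elements of the predicates preserves `P`-independence, so
  by Zorn's lemma any very small subset of `P(M)` can be added
  (`LovelyPairs.IsPartialIso.exists_extend_P`).
* If `b ∉ P(M)`, local character applied to `b` over `A ∪ P(M)` yields a very small `B ⊆ P(M)` with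
  `b ⫝_{A ∪ B} P(M)`. After `B` has been added to the domain, the extension property of the other
  pair gives an image `b'` of `b` that is independent from `P(M')` over the image; by transitivity
  `P`-independence is preserved. Moreover `b' ∉ P(M')`: otherwise `b'` would be independent from
  itself over the `P`-part of the image, hence so would be `b` over `P(A)`, and density of the first
  pair would put `b` into `P(M)` (`LovelyPairs.IsPartialIso.exists_insert_of_ind`).
-/

namespace LovelyPairs

/-! ### Graphs of partial elementary maps -/

section Graph

variable {L : FirstOrder.Language.{u, v}} {C : Type w} [L.Structure C]

/-- The relation `G` is the graph of a partial elementary map of `C`: enumerating `G` by itself, its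
first and its second coordinates have the same `L`-type. -/
def IsElementaryGraph (L : FirstOrder.Language.{u, v}) {C : Type w} [L.Structure C]
    (G : Set (C × C)) : Prop :=
  SameType L (fun p : G => p.1.1) (fun p : G => p.1.2)

theorem IsElementaryGraph.realize_iff {G : Set (C × C)} (hG : IsElementaryGraph L G)
    {α : Type*} {s t : α → C} (h : ∀ i, (s i, t i) ∈ G) (φ : L.Formula α) :
    φ.Realize s ↔ φ.Realize t := by
  have := hG (φ.relabel fun i => ⟨(s i, t i), h i⟩)
  simpa only [Language.Formula.realize_relabel, Function.comp_def] using this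

theorem IsElementaryGraph.swap {G : Set (C × C)} (hG : IsElementaryGraph L G) :
    IsElementaryGraph L (Prod.swap ⁻¹' G) :=
  fun φ => (hG.realize_iff (s := fun p : (Prod.swap ⁻¹' G : Set (C × C)) => p.1.2)
    (t := fun p => p.1.1) (fun p => p.2) φ).symm

theorem IsElementaryGraph.fst_eq_iff {G : Set (C × C)} (hG : IsElementaryGraph L G) {p q : C × C}
    (hp : p ∈ G) (hq : q ∈ G) : p.1 = q.1 ↔ p.2 = q.2 := by
  have := hG.realize_iff (s := ![p.1, q.1]) (t := ![p.2, q.2])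
    (by intro i; fin_cases i <;> simpa) ((Language.var 0).equal (Language.var 1))
  simpa [Language.Formula.realize_equal] using this

theorem IsElementaryGraph.injOn_fst {G : Set (C × C)} (hG : IsElementaryGraph L G) :
    Set.InjOn Prod.fst G :=
  fun _ hp _ hq h => Prod.ext h ((hG.fst_eq_iff hp hq).1 h)

/-- Elementarity of a graph concerns finitely many of its points at a time. -/
theorem IsElementaryGraph.sUnion {c : Set (Set (C × C))} (hne : c.Nonempty)
    (hc : IsChain (· ⊆ ·) c) (h : ∀ G ∈ c, IsElementaryGraph L G) :
    IsElementaryGraph L (⋃₀ c) := by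
  classical
  intro φ
  obtain ⟨G, hGc, hG⟩ := hc.directedOn.exists_mem_subset_of_finite_of_subset_sUnion hne
    (φ.freeVarFinset.finite_toSet.image Subtype.val)
    (by rintro _ ⟨p, -, rfl⟩; exact p.2)
  have := (h G hGc).realize_iff (s := fun p : φ.freeVarFinset => p.1.1.1)
    (t := fun p => p.1.1.2) (fun p => hG ⟨p.1, p.2, rfl⟩) (φ.restrictFreeVar id)
  rwa [Language.Formula.Realize, Language.Formula.Realize,
    Language.BoundedFormula.realize_restrictFreeVar (f := id)
      (fun p : (⋃₀ c : Set (C × C)) => p.1.1) (fun _ => rfl),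
    Language.BoundedFormula.realize_restrictFreeVar (f := id)
      (fun p : (⋃₀ c : Set (C × C)) => p.1.2) (fun _ => rfl)] at this

/-- In a monster model a small partial elementary map extends to an automorphism. -/
theorem IsElementaryGraph.exists_equiv {T : L.Theory} [Nonempty C] {μ : Cardinal.{w}}
    (hC : IsMonsterModel T C μ) {G : Set (C × C)} (hG : IsElementaryGraph L G) (hμ : #G < μ) :
    ∃ σ : C ≃[L] C, ∀ p ∈ G, σ p.1 = p.2 := by
  choose s hs using fun a : (Prod.fst '' G) => a.2
  obtain ⟨σ, hσ⟩ := hC.homogeneous (Prod.fst '' G) (fun a => (s a).2)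
    (mk_image_le.trans_lt hμ)
    (fun φ => hG.realize_iff (fun a => by
      have : ((a : C), (s a).2) = s a := Prod.ext (hs a).2.symm rfl
      rw [this]; exact (hs a).1) φ)
  refine ⟨σ, fun p hp => ?_⟩
  have h := hs ⟨p.1, p, hp, rfl⟩
  exact (hσ ⟨p.1, p, hp, rfl⟩).trans ((hG.fst_eq_iff h.1 hp).1 h.2)

end Graph

section OneTypes

variable {L : FirstOrder.Language.{u, v}} {C : Type w} [L.Structure C] [Nonempty C]

/-- The complete type of `c` over `A`. -/
noncomputable def typeOver (L : FirstOrder.Language.{u, v}) {C : Type w} [L.Structure C]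
    [Nonempty C] (A : Set C) (c : C) : OneType L A :=
  (L[[A]].completeTheory C).typeOf fun _ => c

/-- Two elements with the same type over `A` satisfy the same `L`-formulas with parameters
from `A`. -/
theorem Realizes.realize_iff {A : Set C} {b c : C} (h : Realizes b (typeOver L A c))
    (φ : L.Formula (A ⊕ Fin 1)) :
    φ.Realize (Sum.elim (fun a : A => (a : C)) fun _ => b) ↔
      φ.Realize (Sum.elim (fun a : A => (a : C)) fun _ => c) := by
  have key (d : C) : φ.Realize (Sum.elim (fun a : A => (a : C)) fun _ => d) ↔
      Language.Formula.equivSentence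
        (Language.BoundedFormula.constantsVarsEquiv.symm φ : L[[A]].Formula (Fin 1)) ∈
          typeOver L A d := by
    rw [typeOver, Language.Theory.CompleteType.formula_mem_typeOf, Language.Formula.Realize,
      Language.Formula.Realize, ← Language.BoundedFormula.realize_constantsVarsEquiv,
      Equiv.apply_symm_apply]
    rfl
  have h' : typeOver L A b = typeOver L A c := h
  rw [key b, key c, h']

theorem Realizes.eq_of_mem {A : Set C} {b c : C} (h : Realizes b (typeOver L A c))
    (hc : c ∈ A) : b = c := by
  have := h.realize_iff ((Language.var (Sum.inr 0)).equal (Language.var (Sum.inl ⟨c, hc⟩)))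
  simpa [Language.Formula.realize_equal] using this

/-- A partial elementary map, extended to `σ`, may be prolonged to `b` by sending it to any
realization of the type of `σ b` over the image. -/
theorem IsElementaryGraph.insert_of_realizes {G : Set (C × C)} {σ : C ≃[L] C}
    (hσ : ∀ p ∈ G, σ p.1 = p.2)
    {b b' : C} (h : Realizes b' (typeOver L (Prod.snd '' G) (σ b))) :
    IsElementaryGraph L (insert (b, b') G) := by
  classical
  intro φ
  let r : (insert (b, b') G : Set (C × C)) → (Prod.snd '' G) ⊕ Fin 1 := fun p =>
    if hp : p.1 ∈ G then Sum.inl ⟨p.1.2, p.1, hp, rfl⟩ else Sum.inr 0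
  have hr {p : (insert (b, b') G : Set (C × C))} (hp : p.1 ∉ G) : p.1 = (b, b') :=
    p.2.resolve_right hp
  have h1 : (Sum.elim (fun a : (Prod.snd '' G) => (a : C)) fun _ => σ b) ∘ r =
      σ ∘ fun p => p.1.1 := by
    funext p
    by_cases hp : p.1 ∈ G
    · simp [r, hp, hσ _ hp]
    · have hbG : (b, b') ∉ G := hr hp ▸ hp
      simp [r, hr hp, hbG]
  have h2 : (Sum.elim (fun a : (Prod.snd '' G) => (a : C)) fun _ => b') ∘ r =
      fun p => p.1.2 := by
    funext p
    by_cases hp : p.1 ∈ G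
    · simp [r, hp]
    · have hbG : (b, b') ∉ G := hr hp ▸ hp
      simp [r, hr hp, hbG]
  have := h.realize_iff (φ.relabel r)
  rw [Language.Formula.realize_relabel, Language.Formula.realize_relabel, h1, h2] at this
  exact (Language.StrongHomClass.realize_formula σ φ).symm.trans this.symm

end OneTypes

/-! ### Independence calculus -/

section Independence

variable {L : FirstOrder.Language.{u, v}} {C : Type w} [L.Structure C] {μ : Cardinal.{w}}
  {Ind : Set C → Set C → Set C → Prop}

theorem small_union (hμ : ℵ₀ ≤ μ) {A B : Set C} (hA : #A < μ) (hB : #B < μ) :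
    #(A ∪ B : Set C) < μ :=
  (mk_union_le A B).trans_lt (add_lt_of_lt hμ hA hB)

theorem small_insert (hμ : ℵ₀ ≤ μ) {α : Type w} {A : Set α} {b : α} (hA : #A < μ) :
    #(insert b A : Set α) < μ :=
  mk_insert_le.trans_lt (add_lt_of_lt hμ hA (one_lt_aleph0.trans_le hμ))

theorem small_singleton (hμ : ℵ₀ ≤ μ) (b : C) : #({b} : Set C) < μ := by
  rw [mk_singleton]; exact one_lt_aleph0.trans_le hμ

theorem small_subset {A B : Set C} (hB : #B < μ) (h : A ⊆ B) : #A < μ :=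
  (mk_le_mk_of_subset h).trans_lt hB

theorem IsIndependenceRelation.mono_left (hInd : IsIndependenceRelation L μ Ind)
    {A A₀ B D : Set C} (hA : #A < μ) (hB : #B < μ) (hD : #D < μ) (h : Ind A B D) (hA₀ : A₀ ⊆ A) :
    Ind A₀ B D :=
  (hInd.finite_character A₀ B D (small_subset hA hA₀) hB hD).2 fun F hF hfin =>
    (hInd.finite_character A B D hA hB hD).1 h F (hF.trans hA₀) hfin

theorem IsIndependenceRelation.mono_right (hInd : IsIndependenceRelation L μ Ind)
    {A B D D₀ : Set C} (hA : #A < μ) (hB : #B < μ) (hD : #D < μ) (h : Ind A B D) (hD₀ : D₀ ⊆ D) :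
    Ind A B D₀ :=
  hInd.symmetry _ _ _ (small_subset hD hD₀) hB hA
    (hInd.mono_left hD hB hA (hInd.symmetry _ _ _ hA hB hD h) hD₀)

theorem IsIndependenceRelation.base_mono (hInd : IsIndependenceRelation L μ Ind)
    {A B D E : Set C} (hA : #A < μ) (hE : #E < μ) (hBD : B ⊆ D) (hDE : D ⊆ E) (h : Ind A B E) :
    Ind A D E :=
  ((hInd.transitivity A B D E hA (small_subset hE (hBD.trans hDE)) (small_subset hE hDE) hE
    hBD hDE).1 h).2

/-- Transitivity on the left. -/
theorem IsIndependenceRelation.insert_left (hInd : IsIndependenceRelation L μ Ind) (hμ : ℵ₀ ≤ μ)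
    {A B D : Set C} {b : C} (hA : #A < μ) (hD : #D < μ) (hBA : B ⊆ A) (h : Ind A B D)
    (hb : Ind {b} A D) : Ind (insert b A) B D := by
  have hB := small_subset hA hBA
  have hbA : #(insert b A : Set C) < μ := small_insert hμ hA
  have h1 : Ind (insert b A) A D := hInd.normality _ _ _ (small_singleton hμ b) hA hD hb
  exact hInd.symmetry _ _ _ hD hB hbA <|
    (hInd.transitivity D B A (insert b A) hD hB hA hbA hBA (Set.subset_insert b A)).2
      ⟨hInd.symmetry _ _ _ hA hB hD h, hInd.symmetry _ _ _ hbA hA hD h1⟩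

/-- A `P`-independent set remains so when elements of `P(M)` are added to it. -/
theorem PIndependent.union (hInd : IsIndependenceRelation L μ Ind) (hμ : ℵ₀ ≤ μ) {X : Pair L C}
    (hP : #X.P < μ) {A B : Set C} (hA : #A < μ) (h : PIndependent Ind X A) (hB : B ⊆ X.P) :
    PIndependent Ind X (A ∪ B) := by
  have hE : X.P ∩ (A ∪ B) ⊆ X.P := Set.inter_subset_left
  have h1 : Ind A (X.P ∩ (A ∪ B)) X.P :=
    hInd.base_mono hA hP (Set.inter_subset_inter_right _ Set.subset_union_left) hE h
  have h2 := hInd.normality _ _ _ hA (small_subset hP hE) hP h1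
  refine hInd.mono_left (small_union hμ hA (small_subset hP hE)) (small_subset hP hE) hP h2 ?_
  exact Set.union_subset Set.subset_union_left fun b hb => Or.inr ⟨hB hb, Or.inr hb⟩

/-- Local character shows that some regular cardinal is as in the definition of `κ₀`, so that `κ₀`
itself is. -/
theorem IsIndependenceRelation.exists_base (hInd : IsIndependenceRelation L μ Ind) (hμ : ℵ₀ ≤ μ)
    {A B : Set C} (hA : A.Finite) (hB : #B < μ) :
    ∃ B₀ ⊆ B, #B₀ < kappaZero μ Ind ∧ Ind A B₀ B := by
  have hne : {κ : Cardinal.{w} | κ.IsRegular ∧ ∀ A B : Set C, A.Finite → #B < μ →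
      ∃ B₀ ⊆ B, #B₀ < κ ∧ Ind A B₀ B}.Nonempty := by
    obtain ⟨κ₀, -, h⟩ := hInd.local_character
    refine ⟨Order.succ (max κ₀ ℵ₀), isRegular_succ (le_max_right _ _), fun A B hA hB => ?_⟩
    have hA' : #A < ℵ₀ := lt_aleph0_iff_set_finite.2 hA
    obtain ⟨B₀, hB₀, hlt, hi⟩ := h A B (hA'.trans_le hμ) hB
    refine ⟨B₀, hB₀, Order.lt_succ_of_le (hlt.le.trans ?_), hi⟩
    exact add_le_of_le (le_max_right _ _) (le_max_left _ _)
      ((Order.succ_le_of_lt hA').trans (le_max_right _ _))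
  exact (csInf_mem hne).2 A B hA hB

end Independence

/-! ### The back-and-forth system -/

section BackAndForth

variable {L : FirstOrder.Language.{u, v}} {T : L.Theory} {C : Type w} [L.Structure C]
  {μ κ : Cardinal.{w}} {Ind : Set C → Set C → Set C → Prop} {X X' : Pair L C}

/-- The graph of a very small partial elementary map between the pairs `X` and `X'` that respects
the predicate `P` and has a `P`-independent domain and image. -/
structure IsPartialIso (κ : Cardinal.{w}) (Ind : Set C → Set C → Set C → Prop) (X X' : Pair L C)
    (G : Set (C × C)) : Prop where
  card_lt : #G < κ
  fst_subset : Prod.fst '' G ⊆ (X.M : Set C)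
  snd_subset : Prod.snd '' G ⊆ (X'.M : Set C)
  elementary : IsElementaryGraph L G
  mem_P_iff : ∀ p ∈ G, p.1 ∈ X.P ↔ p.2 ∈ X'.P
  fst_indep : PIndependent Ind X (Prod.fst '' G)
  snd_indep : PIndependent Ind X' (Prod.snd '' G)

theorem IsPartialIso.swap {G : Set (C × C)} (hG : IsPartialIso κ Ind X X' G) :
    IsPartialIso κ Ind X' X (Prod.swap ⁻¹' G) := by
  have h1 : Prod.fst '' (Prod.swap ⁻¹' G) = Prod.snd '' G := by ext; simp
  have h2 : Prod.snd '' (Prod.swap ⁻¹' G) = Prod.fst '' G := by ext; simp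
  refine ⟨?_, h1 ▸ hG.snd_subset, h2 ▸ hG.fst_subset, hG.elementary.swap,
    fun p hp => (hG.mem_P_iff _ hp).symm, h1 ▸ hG.snd_indep, h2 ▸ hG.fst_indep⟩
  rw [← Set.image_swap_eq_preimage_swap]
  exact mk_image_le.trans_lt hG.card_lt

theorem image_fst_eq {G : Set (C × C)} {σ : C → C} (hσ : ∀ p ∈ G, σ p.1 = p.2) :
    σ '' (Prod.fst '' G) = Prod.snd '' G := by
  rw [Set.image_image]
  exact Set.image_congr hσ

theorem IsPartialIso.image_P {G : Set (C × C)} (hG : IsPartialIso κ Ind X X' G) {σ : C → C}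
    (hσ : ∀ p ∈ G, σ p.1 = p.2) :
    σ '' (X.P ∩ Prod.fst '' G) = X'.P ∩ Prod.snd '' G := by
  ext c
  constructor
  · rintro ⟨_, ⟨hp, p, hpG, rfl⟩, rfl⟩
    rw [hσ p hpG]
    exact ⟨(hG.mem_P_iff p hpG).1 hp, p, hpG, rfl⟩
  · rintro ⟨hp, p, hpG, rfl⟩
    exact ⟨p.1, ⟨(hG.mem_P_iff p hpG).2 hp, p, hpG, rfl⟩, hσ p hpG⟩

variable [Nonempty C]

theorem IsLovely.card_P_lt (hX : IsLovely μ κ Ind X) : #X.P < μ :=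
  small_subset hX.small X.P_subset

/-- An element `b` of `P(M)` is independent from the domain of a partial isomorphism over the
`P`-part of the domain, so the density property of the other pair provides an image for it. -/
theorem IsPartialIso.exists_insert_of_mem_P (hC : IsMonsterModel T C μ)
    (hInd : IsIndependenceRelation L μ Ind) (hμ : ℵ₀ ≤ μ) (hκ : κ < μ)
    (hX : IsLovely μ κ Ind X) (hX' : IsLovely μ κ Ind X') {G : Set (C × C)}
    (hG : IsPartialIso κ Ind X X' G) {b : C} (hb : b ∈ X.P) :
    ∃ b' ∈ X'.P, IsElementaryGraph L (insert (b, b') G) := by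
  obtain ⟨σ, hσ⟩ := hG.elementary.exists_equiv hC (hG.card_lt.trans hκ)
  have hA : #(Prod.fst '' G) < μ := (mk_image_le.trans_lt hG.card_lt).trans hκ
  have hPA : #(X.P ∩ Prod.fst '' G : Set C) < μ := small_subset hA Set.inter_subset_right
  have hbs := small_singleton hμ b
  have hi : Ind {b} (X.P ∩ Prod.fst '' G) (Prod.fst '' G) :=
    hInd.symmetry _ _ _ hA hPA hbs <| hInd.mono_right hA hPA hX.card_P_lt hG.fst_indep
      (Set.singleton_subset_iff.2 hb)
  have hi' := hInd.invariance _ _ _ hbs hPA hA σ hi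
  rw [Set.image_singleton, hG.image_P hσ, image_fst_eq hσ] at hi'
  obtain ⟨b', hb', hr⟩ := hX'.density (Prod.snd '' G) hG.snd_subset
    (mk_image_le.trans_lt hG.card_lt) (typeOver L _ (σ b)) ⟨σ b, rfl, hi'⟩
  exact ⟨b', hb', IsElementaryGraph.insert_of_realizes hσ hr⟩

/-- A partial isomorphism extends to any very small set `B` of elements of `P(M)`. An extension by
pairs of elements of the predicates is automatically a partial isomorphism if it is elementary, so
Zorn's lemma applies to these. -/
theorem IsPartialIso.exists_extend_P (hC : IsMonsterModel T C μ)
    (hInd : IsIndependenceRelation L μ Ind) (hκ₀ : ℵ₀ ≤ κ) (hκ : κ < μ)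
    (hX : IsLovely μ κ Ind X) (hX' : IsLovely μ κ Ind X') {G : Set (C × C)}
    (hG : IsPartialIso κ Ind X X' G) {B : Set C} (hB : B ⊆ X.P) (hBκ : #B < κ) :
    ∃ H, G ⊆ H ∧ IsPartialIso κ Ind X X' H ∧ Prod.fst '' H = Prod.fst '' G ∪ B := by
  have hμ : ℵ₀ ≤ μ := hκ₀.trans hκ.le
  let S : Set (Set (C × C)) :=
    {H | G ⊆ H ∧ IsElementaryGraph L H ∧ ∀ p ∈ H, p ∈ G ∨ p.1 ∈ B ∧ p.2 ∈ X'.P}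
  have hS : ∀ H ∈ S, IsPartialIso κ Ind X X' H := by
    rintro H ⟨hGH, hel, hH⟩
    have hfst : Prod.fst '' H ⊆ Prod.fst '' G ∪ B := by
      rintro _ ⟨p, hp, rfl⟩
      exact (hH p hp).imp (fun h => ⟨p, h, rfl⟩) fun h => h.1
    have h1 : Prod.fst '' H = Prod.fst '' G ∪ (Prod.fst '' H ∩ B) := by
      apply Set.Subset.antisymm
      · exact fun c hc => (hfst hc).imp id fun h => ⟨hc, h⟩
      · exact Set.union_subset (Set.image_mono hGH) Set.inter_subset_left
    have h2 : Prod.snd '' H = Prod.snd '' G ∪ (Prod.snd '' H ∩ X'.P) := by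
      apply Set.Subset.antisymm
      · rintro _ ⟨p, hp, rfl⟩
        exact (hH p hp).imp (fun h => ⟨p, h, rfl⟩) fun h => ⟨⟨p, hp, rfl⟩, h.2⟩
      · exact Set.union_subset (Set.image_mono hGH) Set.inter_subset_left
    refine ⟨?_, ?_, ?_, hel, ?_, ?_, ?_⟩
    · rw [← mk_image_eq_of_injOn _ _ hel.injOn_fst]
      exact small_subset (small_union hκ₀ (mk_image_le.trans_lt hG.card_lt) hBκ) hfst
    · exact hfst.trans (Set.union_subset hG.fst_subset (hB.trans X.P_subset))
    · rw [h2]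
      exact Set.union_subset hG.snd_subset (Set.inter_subset_right.trans X'.P_subset)
    · intro p hp
      rcases hH p hp with h | h
      · exact hG.mem_P_iff p h
      · exact iff_of_true (hB h.1) h.2
    · rw [h1]
      exact hG.fst_indep.union hInd hμ hX.card_P_lt
        ((mk_image_le.trans_lt hG.card_lt).trans hκ) (Set.inter_subset_right.trans hB)
    · rw [h2]
      exact hG.snd_indep.union hInd hμ hX'.card_P_lt
        ((mk_image_le.trans_lt hG.card_lt).trans hκ) Set.inter_subset_right
  obtain ⟨H, hGH, hH⟩ := zorn_subset_nonempty S (fun c hc hchain hne =>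
    ⟨⋃₀ c, ⟨by
      obtain ⟨K, hK⟩ := hne
      exact (hc hK).1.trans (Set.subset_sUnion_of_mem hK),
      IsElementaryGraph.sUnion hne hchain fun K hK => (hc hK).2.1,
      fun p ⟨K, hK, hp⟩ => (hc hK).2.2 p hp⟩, fun K hK => Set.subset_sUnion_of_mem hK⟩) G
    ⟨subset_rfl, hG.elementary, fun p hp => Or.inl hp⟩
  refine ⟨H, hGH, hS H hH.prop, Set.Subset.antisymm ?_
    (Set.union_subset (Set.image_mono hGH) fun b hb => ?_)⟩
  · rintro _ ⟨p, hp, rfl⟩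
    exact (hH.prop.2.2 p hp).imp (fun h => ⟨p, h, rfl⟩) fun h => h.1
  · obtain ⟨b', hb', hel⟩ := (hS H hH.prop).exists_insert_of_mem_P hC hInd hμ hκ hX hX' (hB hb)
    have hmem : insert (b, b') H ∈ S := by
      refine ⟨hGH.trans (Set.subset_insert _ _), hel, ?_⟩
      rintro p (rfl | hp)
      · exact Or.inr ⟨hb, hb'⟩
      · exact hH.prop.2.2 p hp
    exact ⟨(b, b'), hH.le_of_ge hmem (Set.subset_insert _ _) (Set.mem_insert _ _), rfl⟩

/-- A partial isomorphism with domain `A` extends to an element `b` outside `P(M)` that is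
independent from `P(M)` over `A`. -/
theorem IsPartialIso.exists_insert_of_ind (hC : IsMonsterModel T C μ)
    (hInd : IsIndependenceRelation L μ Ind) (hκ₀ : ℵ₀ ≤ κ) (hκ : κ < μ)
    (hX : IsLovely μ κ Ind X) (hX' : IsLovely μ κ Ind X') {G : Set (C × C)}
    (hG : IsPartialIso κ Ind X X' G) {b : C} (hbM : b ∈ X.M) (hbP : b ∉ X.P)
    (hb : Ind {b} (Prod.fst '' G) X.P) :
    ∃ b', IsPartialIso κ Ind X X' (insert (b, b') G) := by
  have hμ : ℵ₀ ≤ μ := hκ₀.trans hκ.le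
  have hA : #(Prod.fst '' G) < κ := mk_image_le.trans_lt hG.card_lt
  have hA' : #(Prod.snd '' G) < κ := mk_image_le.trans_lt hG.card_lt
  obtain ⟨σ, hσ⟩ := hG.elementary.exists_equiv hC (hG.card_lt.trans hκ)
  obtain ⟨b', hb'M, hr, hb'⟩ := hX'.extension _ hG.snd_subset hA' (typeOver L _ (σ b))
  have hel := IsElementaryGraph.insert_of_realizes hσ hr
  have hcard : #(insert (b, b') G : Set (C × C)) < κ := small_insert hκ₀ hG.card_lt
  have hind : Ind (insert b (Prod.fst '' G)) (X.P ∩ Prod.fst '' G) X.P :=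
    hInd.insert_left hμ (hA.trans hκ) hX.card_P_lt Set.inter_subset_right hG.fst_indep hb
  have hind' : Ind (insert b' (Prod.snd '' G)) (X'.P ∩ Prod.snd '' G) X'.P :=
    hInd.insert_left hμ (hA'.trans hκ) hX'.card_P_lt Set.inter_subset_right hG.snd_indep hb'
  have hb'P : b' ∉ X'.P := by
    -- Otherwise `b'` is independent from itself over the `P`-part of the image; moving this back
    -- to `b`, density would realize the type of `b` over `b` in `P(M)`, putting `b` there.
    intro hb'P
    have hPA' : #(X'.P ∩ Prod.snd '' G : Set C) < μ :=
      small_subset (hA'.trans hκ) Set.inter_subset_right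
    have h1 : Ind {b'} (X'.P ∩ Prod.snd '' G) (insert b' (Prod.snd '' G)) :=
      hInd.symmetry _ _ _ (small_insert hμ (hA'.trans hκ)) hPA' (small_singleton hμ b') <|
        hInd.mono_right (small_insert hμ (hA'.trans hκ)) hPA' hX'.card_P_lt hind'
          (Set.singleton_subset_iff.2 hb'P)
    obtain ⟨τ, hτ⟩ := hel.swap.exists_equiv hC <| by
      rw [← Set.image_swap_eq_preimage_swap]
      exact mk_image_le.trans_lt (hcard.trans hκ)
    have hτG : ∀ p ∈ Prod.swap ⁻¹' G, τ p.1 = p.2 := fun p hp => hτ p (Or.inr hp)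
    have hτb : τ b' = b := hτ (b', b) (Or.inl rfl)
    have e1 := hG.swap.image_P hτG
    have e2 := image_fst_eq hτG
    have e3 : Prod.fst '' (Prod.swap ⁻¹' G) = Prod.snd '' G := by ext; simp
    have e4 : Prod.snd '' (Prod.swap ⁻¹' G) = Prod.fst '' G := by ext; simp
    rw [e3, e4] at e1 e2
    have h2 := hInd.invariance _ _ _ (small_singleton hμ b') hPA'
      (small_insert hμ (hA'.trans hκ)) τ h1
    rw [Set.image_singleton, Set.image_insert_eq, e1, e2, hτb,
      ← Set.inter_insert_of_notMem hbP] at h2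
    obtain ⟨c, hcP, hc⟩ := hX.density (insert b (Prod.fst '' G))
      (Set.insert_subset hbM hG.fst_subset) (small_insert hκ₀ hA) (typeOver L _ b) ⟨b, rfl, h2⟩
    rw [hc.eq_of_mem (Set.mem_insert b _)] at hcP
    exact hbP hcP
  refine ⟨b', hcard, ?_, ?_, hel, ?_, ?_, ?_⟩
  · rw [Set.image_insert_eq]
    exact Set.insert_subset hbM hG.fst_subset
  · rw [Set.image_insert_eq]
    exact Set.insert_subset hb'M hG.snd_subset
  · rintro p (rfl | hp)
    · exact iff_of_false hbP hb'P
    · exact hG.mem_P_iff p hp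
  · rw [Set.image_insert_eq, PIndependent, Set.inter_insert_of_notMem hbP]
    exact hind
  · rw [Set.image_insert_eq, PIndependent, Set.inter_insert_of_notMem hb'P]
    exact hind'

theorem IsPartialIso.forth (hC : IsMonsterModel T C μ)
    (hInd : IsIndependenceRelation L μ Ind) (hκ₀ : ℵ₀ ≤ κ) (hκ : κ < μ)
    (hκz : kappaZero μ Ind < κ) (hX : IsLovely μ κ Ind X) (hX' : IsLovely μ κ Ind X')
    {G : Set (C × C)} (hG : IsPartialIso κ Ind X X' G) {b : C} (hb : b ∈ X.M) :
    ∃ H, G ⊆ H ∧ IsPartialIso κ Ind X X' H ∧ ∃ b', (b, b') ∈ H := by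
  have hμ : ℵ₀ ≤ μ := hκ₀.trans hκ.le
  by_cases hbP : b ∈ X.P
  · obtain ⟨H, hGH, hH, hfst⟩ := hG.exists_extend_P hC hInd hκ₀ hκ hX hX'
      (Set.singleton_subset_iff.2 hbP) (small_singleton hκ₀ b)
    obtain ⟨p, hp, rfl⟩ : b ∈ Prod.fst '' H := hfst ▸ Or.inr rfl
    exact ⟨H, hGH, hH, p.2, hp⟩
  · -- Local character provides very few elements of `P(M)` over which, together with the domain,
    -- `b` becomes independent from `P(M)`; these are added to the domain first.
    have hA : #(Prod.fst '' G) < μ := (mk_image_le.trans_lt hG.card_lt).trans hκ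
    have hAP := small_union hμ hA hX.card_P_lt
    obtain ⟨B₀, hB₀, hB₀κ, hi⟩ := hInd.exists_base hμ (Set.finite_singleton b) hAP
    have hBκ : #(B₀ ∩ X.P : Set C) < κ :=
      (mk_le_mk_of_subset Set.inter_subset_left).trans_lt (hB₀κ.trans hκz)
    obtain ⟨H, hGH, hH, hfst⟩ := hG.exists_extend_P hC hInd hκ₀ hκ hX hX'
      (B := B₀ ∩ X.P) Set.inter_subset_right hBκ
    have hD : Prod.fst '' G ∪ B₀ ∩ X.P ⊆ Prod.fst '' G ∪ X.P :=
      Set.union_subset_union_right _ Set.inter_subset_right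
    have h1 : Ind {b} (Prod.fst '' G ∪ B₀ ∩ X.P) (Prod.fst '' G ∪ X.P) :=
      hInd.base_mono (small_singleton hμ b) hAP
        (fun c hc => (hB₀ hc).imp id fun h => ⟨hc, h⟩) hD hi
    have h2 := hInd.mono_right (small_singleton hμ b) (small_subset hAP hD) hAP h1
      Set.subset_union_right
    rw [← hfst] at h2
    obtain ⟨b', hb'⟩ := hH.exists_insert_of_ind hC hInd hκ₀ hκ hX hX' hb hbP h2
    exact ⟨_, hGH.trans (Set.subset_insert _ _), hb', b', Set.mem_insert _ _⟩

theorem IsPartialIso.back (hC : IsMonsterModel T C μ)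
    (hInd : IsIndependenceRelation L μ Ind) (hκ₀ : ℵ₀ ≤ κ) (hκ : κ < μ)
    (hκz : kappaZero μ Ind < κ) (hX : IsLovely μ κ Ind X) (hX' : IsLovely μ κ Ind X')
    {G : Set (C × C)} (hG : IsPartialIso κ Ind X X' G) {b' : C} (hb' : b' ∈ X'.M) :
    ∃ H, G ⊆ H ∧ IsPartialIso κ Ind X X' H ∧ ∃ b, (b, b') ∈ H := by
  obtain ⟨H, hGH, hH, b, hb⟩ := hG.swap.forth hC hInd hκ₀ hκ hκz hX' hX hb'
  exact ⟨Prod.swap ⁻¹' H, fun p hp => hGH (by simpa using hp), hH.swap, b, hb⟩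

end BackAndForth

/-! ### Formulas of the expanded language -/

section Formulas

variable {L : FirstOrder.Language.{u, v}} {T : L.Theory} {C : Type w} [L.Structure C]
  {μ κ : Cardinal.{w}} {Ind : Set C → Set C → Set C → Prop} {X X' : Pair L C}

/-- The terms of `L²` are the terms of `L`. -/
def termToBase {α : Type*} : (pairLang L).Term α → L.Term α
  | .var i => .var i
  | .func (Sum.inl f) ts => .func f fun i => termToBase (ts i)

theorem realize_termToBase {α : Type*} (X : Pair L C) (s : α → X.M) (t : (pairLang L).Term α) :
    (termToBase t).realize (fun i => (s i : C)) = (t.realize s : X.M) := by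
  induction t with
  | var i => rfl
  | func f ts ih =>
    match f with
    | Sum.inl f =>
      simp only [termToBase, Language.Term.realize, ih]
      rfl
    | Sum.inr f => exact f.elim

/-- Partial isomorphisms preserve and reflect all formulas of `L²`. For an atomic formula `P(t)`,
the value of the term `t` is first put into the domain. -/
theorem IsPartialIso.realize_iff [Nonempty C] (hC : IsMonsterModel T C μ)
    (hInd : IsIndependenceRelation L μ Ind) (hκ₀ : ℵ₀ ≤ κ) (hκ : κ < μ)
    (hκz : kappaZero μ Ind < κ) (hX : IsLovely μ κ Ind X) (hX' : IsLovely μ κ Ind X')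
    {α : Type x} {n : ℕ} (φ : (pairLang L).BoundedFormula α n) {G : Set (C × C)}
    (hG : IsPartialIso κ Ind X X' G) {s : α → X.M} {s' : α → X'.M} {r : Fin n → X.M}
    {r' : Fin n → X'.M} (hs : ∀ i, ((s i : C), (s' i : C)) ∈ G)
    (hr : ∀ i, ((r i : C), (r' i : C)) ∈ G) : φ.Realize s r ↔ φ.Realize s' r' := by
  have hsr {n : ℕ} {G : Set (C × C)} {r : Fin n → X.M} {r' : Fin n → X'.M}
      (hs : ∀ i, ((s i : C), (s' i : C)) ∈ G) (hr : ∀ i, ((r i : C), (r' i : C)) ∈ G) :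
      ∀ i, (((Sum.elim s r i : X.M) : C), ((Sum.elim s' r' i : X'.M) : C)) ∈ G := by
    rintro (i | i)
    exacts [hs i, hr i]
  induction φ generalizing G with
  | falsum => rfl
  | equal t₁ t₂ =>
    have := hG.elementary.realize_iff (hsr hs hr) ((termToBase t₁).equal (termToBase t₂))
    simp only [Language.Formula.realize_equal, realize_termToBase, SetLike.coe_eq_coe] at this
    exact this
  | rel R ts =>
    rcases R with R | R
    · have := hG.elementary.realize_iff (hsr hs hr) (R.formula fun i => termToBase (ts i))
      simp only [Language.Formula.realize_rel, realize_termToBase] at this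
      exact this
    · change predRel _ at R
      cases R
      obtain ⟨H, hGH, hH, c, hc⟩ := hG.forth hC hInd hκ₀ hκ hκz hX hX'
        ((ts 0).realize (Sum.elim s r)).2
      have h1 := hH.elementary.realize_iff
        (s := fun i => Option.elim i (((ts 0).realize (Sum.elim s r) : X.M) : C)
          fun i => ((Sum.elim s r i : X.M) : C))
        (t := fun i => Option.elim i c fun i => ((Sum.elim s' r' i : X'.M) : C))
        (by
          rintro (_ | i)
          exacts [hc, hGH (hsr hs hr i)])
        ((Language.var none).equal ((termToBase (ts 0)).relabel some))
      simp only [Language.Formula.realize_equal, Language.Term.realize_relabel,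
        Language.Term.realize_var, Function.comp_def, Option.elim, realize_termToBase,
        true_iff] at h1
      have h2 := hH.mem_P_iff _ hc
      rw [h1] at h2
      exact h2
  | imp φ ψ ihφ ihψ =>
    exact imp_congr (ihφ hG hs hr) (ihψ hG hs hr)
  | all φ ih =>
    have hsnoc {H : Set (C × C)} (hGH : G ⊆ H) {b : X.M} {b' : X'.M}
        (hb : ((b : C), (b' : C)) ∈ H) (i) :
        (((Fin.snoc (α := fun _ => X.M) r b i : X.M) : C),
          ((Fin.snoc (α := fun _ => X'.M) r' b' i : X'.M) : C)) ∈ H := by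
      induction i using Fin.lastCases with
      | last => simpa using hb
      | cast i => simpa using hGH (hr i)
    constructor
    · intro h b'
      obtain ⟨H, hGH, hH, b, hb⟩ := hG.back hC hInd hκ₀ hκ hκz hX hX' b'.2
      have hbM : b ∈ X.M := hH.fst_subset ⟨_, hb, rfl⟩
      exact (ih hH (fun i => hGH (hs i)) (hsnoc hGH (b := ⟨b, hbM⟩) hb)).1 (h ⟨b, hbM⟩)
    · intro h b
      obtain ⟨H, hGH, hH, b', hb⟩ := hG.forth hC hInd hκ₀ hκ hκz hX hX' b.2
      have hbM : b' ∈ X'.M := hH.snd_subset ⟨_, hb, rfl⟩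
      exact (ih hH (fun i => hGH (hs i)) (hsnoc hGH (b' := ⟨b', hbM⟩) hb)).2 (h ⟨b', hbM⟩)

end Formulas

end LovelyPairs

open LovelyPairs in
theorem mainTheorem2 {L : FirstOrder.Language.{u, v}} {T : L.Theory}
    {C : Type w} [L.Structure C] [Nonempty C] {μ : Cardinal.{w}}
    (hC : LovelyPairs.IsMonsterModel T C μ)
    {Ind : Set C → Set C → Set C → Prop}
    (hInd : LovelyPairs.IsIndependenceRelation L μ Ind)
    {κ : Cardinal.{w}} (hκ_small : κ < μ)
    (hκ_zero : LovelyPairs.kappaZero μ Ind < κ)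
    (hκ_theory : Cardinal.lift.{w, max u v} (LovelyPairs.theoryCard L) < Cardinal.lift.{max u v, w} κ)
    (X X' : LovelyPairs.Pair L C)
    (hX : LovelyPairs.IsLovely μ κ Ind X) (hX' : LovelyPairs.IsLovely μ κ Ind X')
    {ι : Type x} (hι : Cardinal.lift.{w, x} (Cardinal.mk ι) < Cardinal.lift.{x, w} κ)
    (a : ι → X.M) (a' : ι → X'.M)
    (ha : LovelyPairs.PIndependent Ind X (Set.range fun i => (a i : C)))
    (ha' : LovelyPairs.PIndependent Ind X' (Set.range fun i => (a' i : C)))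
    (h_type : LovelyPairs.SameType L a a')
    (h_ptype : LovelyPairs.PType X a = LovelyPairs.PType X' a') :
    LovelyPairs.SameType (LovelyPairs.pairLang L) a a' := by
  have hκ₀ : ℵ₀ ≤ κ := by
    have h : Cardinal.lift.{w, max u v} ℵ₀ < Cardinal.lift.{max u v, w} κ :=
      (lift_le.2 (le_max_left ℵ₀ L.card)).trans_lt hκ_theory
    rw [lift_aleph0, aleph0_lt_lift] at h
    exact h.le
  let g : ι → C × C := fun i => (a i, a' i)
  have hfst : Prod.fst '' Set.range g = Set.range fun i => (a i : C) := by
    rw [← Set.range_comp]; rfl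
  have hsnd : Prod.snd '' Set.range g = Set.range fun i => (a' i : C) := by
    rw [← Set.range_comp]; rfl
  have hG : IsPartialIso κ Ind X X' (Set.range g) := by
    refine ⟨?_, ?_, ?_, fun φ => ?_, ?_, hfst ▸ ha, hsnd ▸ ha'⟩
    · rw [← lift_lt.{w, x}]
      exact mk_range_le_lift.trans_lt hι
    · rw [hfst]
      rintro _ ⟨i, rfl⟩
      exact (a i).2
    · rw [hsnd]
      rintro _ ⟨i, rfl⟩
      exact (a' i).2
    · choose k hk using fun p : Set.range g => p.2
      have h := h_type (φ.relabel k)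
      rw [Language.Formula.realize_relabel, Language.Formula.realize_relabel,
        ← X.M.subtype.map_formula, ← X'.M.subtype.map_formula] at h
      have e1 : X.M.subtype ∘ a ∘ k = fun p : Set.range g => p.1.1 :=
        funext fun p => congrArg Prod.fst (hk p)
      have e2 : X'.M.subtype ∘ a' ∘ k = fun p : Set.range g => p.1.2 :=
        funext fun p => congrArg Prod.snd (hk p)
      rwa [e1, e2] at h
    · rintro _ ⟨i, rfl⟩
      exact Set.ext_iff.1 h_ptype i
  intro φ
  exact hG.realize_iff hC hInd hκ₀ hκ_small hκ_zero hX hX' φ (fun i => ⟨i, rfl⟩)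
    (fun i => i.elim0)
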